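/- Let $n\ge 1$. In $\mathfrak{sl}(n+1)$ (traceless complex $(n+1)\times(n+1)$ matrices, with matrix units $A_{i,j}$) put $H_i=A_{i,i}-A_{i+1,i+1}$ for $1\le i\le n$ and $F_{p,q}=A_{q+1,p}$ for $1\le p\le q\le n$; let $\mathfrak h$ be the diagonal Cartan subalgebra and $\omega_1,\dots,\omega_n\in\mathfrak h^*$ the fundamental weights, $\omega_i(H_j)=\delta_{ij}$, with $\omega_0=\omega_{n+1}=0$. Let $\mathfrak{sl}(n+1)\ltimes\mathbb C^{n+1}$ be the semidirect sum with the standard representation, regarded as an abelian ideal with standard basis $P_1,\dots,P_{n+1}$. For a weight $\mu\in\mathfrak h^*$ write $\mu_i=\mu(H_i)$ and $$\mu_{k,s}=-\sum_{i=k}^{s}(\mu_i+1),\qquad P_i^{(\mu(s))}=\Big(\prod_{k=1}^{i-1}\mu_{k,s-1}\Big)P_i,\qquad F_{i,j}^{(\mu(s))}=\Big(\prod_{k=i+1}^{j}\mu_{k,s}\Big)F_{i,j},$$ and define $Q_k^{(\mu(s))}\in\mathcal U(\mathfrak{sl}(n+1))$ for $1\le k\le s+1$ recursively by $$Q_{s+1}^{(\mu(s))}=1,\qquad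 Q_k^{(\mu(s))}=\sum_{l=k}^{s}Q_{l+1}^{(\mu(s))}F_{k,l}^{(\mu(s))}\quad(1\le k\le s).$$ For a vector $v$ of weight $\mu$ in an $\mathfrak{sl}(n+1)\ltimes\mathbb C^{n+1}$-module and $1\le i\le n+1$ put $$\varphi_i(v)=P_i^{(\mu(i))}v+\sum_{k=1}^{i-1}Q_k^{(\mu(i-1))}P_k^{(\mu(i))}v .$$ **Theorem.** Let $V$ be a finite-dimensional complex $\mathfrak{sl}(n+1)\ltimes\mathbb C^{n+1}$-module and let $v_\mu\in V$ be an $\mathfrak{sl}(n+1)$-highest weight vector of weight $\mu$ (a non-zero vector with $Hv_\mu=\mu(H)v_\mu$ for all $H\in\mathfrak h$, annihilated by all strictly upper triangular matrices). Then for $1\le i\le n+1$ the vector $\varphi_i(v_\mu)$ is either zero or an $\mathfrak{sl}(n+1)$-highest weight vector of weight $\mu+\omega_i-\omega_{i-1}$, so that the $\varphi_j$ may be applied to it with respect to this weight (with $\varphi_j(0)=0$), and $$\varphi_i(\varphi_j(v_\mu))=\varphi_j(\varphi_i(v_\mu))\qquad\text{for all }1\le i,j\le n+1 .$$ -/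

import Mathlib

open LieAlgebra

attribute [local instance] LieRing.ofAssociativeRing

namespace SlSemidirect

/-! Throughout, `n` is the rank. Rows and columns of matrices are indexed by `Fin (n + 1)`, so that
position `a` of the usual numbering `1, …, n + 1` is the element of `Fin (n + 1)` with value
`a - 1`. All other indices are natural numbers in the usual numbering starting from `1`. -/

/-- The Lie algebra `sl(n+1)` of traceless complex matrices of size `n + 1`. -/
abbrev Sl (n : ℕ) : Type := SpecialLinear.sl (Fin (n + 1)) ℂ

/-- The space `ℂ^(n+1)`, regarded as an abelian Lie algebra. -/
def Std (n : ℕ) : Type := Fin (n + 1) → ℂ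

noncomputable instance (n : ℕ) : AddCommGroup (Std n) :=
  inferInstanceAs (AddCommGroup (Fin (n + 1) → ℂ))

noncomputable instance (n : ℕ) : Module ℂ (Std n) :=
  inferInstanceAs (Module ℂ (Fin (n + 1) → ℂ))

noncomputable instance (n : ℕ) : LieRing (Std n) where
  bracket _ _ := 0
  add_lie _ _ _ := (add_zero _).symm
  lie_add _ _ _ := (add_zero _).symm
  lie_self _ := rfl
  leibniz_lie _ _ _ := (add_zero _).symm

noncomputable instance (n : ℕ) : LieAlgebra ℂ (Std n) where
  lie_smul c _ _ := (smul_zero c).symm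

theorem std_lie (n : ℕ) (x y : Std n) : ⁅x, y⁆ = 0 := rfl

/-- The identity map, from column vectors to the abelian Lie algebra `ℂ^(n+1)`. -/
noncomputable def toStd (n : ℕ) : (Fin (n + 1) → ℂ) ≃ₗ[ℂ] Std n :=
  LinearEquiv.refl ℂ (Fin (n + 1) → ℂ)

/-- The standard representation of `sl(n+1)`: a matrix acts on `ℂ^(n+1)` by multiplication. Every
linear endomorphism of an abelian Lie algebra is a derivation. -/
noncomputable def stdAction (n : ℕ) : Sl n →ₗ⁅ℂ⁆ LieDerivation ℂ (Std n) (Std n) where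
  toFun A :=
    { toLinearMap := (toStd n).toLinearMap ∘ₗ Matrix.mulVecLin A.val ∘ₗ (toStd n).symm.toLinearMap
      leibniz' := fun x y => by
        rw [std_lie, std_lie, std_lie, sub_zero]
        exact map_zero _ }
  map_add' A B := by
    apply LieDerivation.ext
    intro x
    exact congrArg (toStd n) (Matrix.add_mulVec A.val B.val ((toStd n).symm x))
  map_smul' c A := by
    apply LieDerivation.ext
    intro x
    exact congrArg (toStd n) (Matrix.smul_mulVec c A.val ((toStd n).symm x))
  map_lie' := by
    intro A B
    apply LieDerivation.ext
    intro x
    rw [LieDerivation.lie_apply]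
    have key : ∀ y : Fin (n + 1) → ℂ, Matrix.mulVec (A.val * B.val - B.val * A.val) y
        = Matrix.mulVec A.val (Matrix.mulVec B.val y)
          - Matrix.mulVec B.val (Matrix.mulVec A.val y) := by
      intro y
      rw [Matrix.sub_mulVec, Matrix.mulVec_mulVec, Matrix.mulVec_mulVec]
    exact congrArg (toStd n) (key ((toStd n).symm x))

theorem stdAction_toStd (n : ℕ) (A : Sl n) (x : Fin (n + 1) → ℂ) :
    stdAction n A (toStd n x) = toStd n (Matrix.mulVec A.val x) := rfl

/-- The perfect Lie algebra `sl(n+1) ⋉ ℂ^(n+1)`. -/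
abbrev G (n : ℕ) : Type := Std n ⋊⁅stdAction n⁆ Sl n

/-- The inclusion of `sl(n+1)` in `sl(n+1) ⋉ ℂ^(n+1)`. -/
noncomputable abbrev incl (n : ℕ) : Sl n →ₗ⁅ℂ⁆ G n := SemiDirectSum.inr (stdAction n)

/-- The Cartan subalgebra of diagonal matrices in `sl(n+1)`. -/
def cartan (n : ℕ) : Submodule ℂ (Sl n) where
  carrier := {A | ∀ a b, a ≠ b → A.val a b = 0}
  add_mem' {A B} hA hB a b h := by
    change A.val a b + B.val a b = 0
    rw [hA a b h, hB a b h, add_zero]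
  zero_mem' _ _ _ := rfl
  smul_mem' c A hA a b h := by
    change c * A.val a b = 0
    rw [hA a b h, mul_zero]

/-- Weights: linear forms on the Cartan subalgebra. -/
abbrev Weight (n : ℕ) : Type := Module.Dual ℂ (cartan n)

/-- The simple coroot `H_i = A_{i,i} - A_{i+1,i+1}` for `1 ≤ i ≤ n` (and `0` otherwise). -/
noncomputable def H (n i : ℕ) : Sl n :=
  if h : 1 ≤ i ∧ i ≤ n then
    SpecialLinear.singleSubSingle ⟨i - 1, by omega⟩ ⟨i, by omega⟩ (1 : ℂ)
  else 0

theorem H_mem (n i : ℕ) : H n i ∈ cartan n := by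
  intro a b hab
  unfold H
  split_ifs with h
  · rw [SpecialLinear.val_singleSubSingle, Matrix.sub_apply, Matrix.single_apply,
      Matrix.single_apply, if_neg, if_neg, sub_zero]
    · rintro ⟨rfl, rfl⟩
      exact hab rfl
    · rintro ⟨rfl, rfl⟩
      exact hab rfl
  · rfl

/-- The coordinate `μ_i = μ(H_i)` of a weight `μ = ∑ μ_i ω_i`. -/
noncomputable def coord {n : ℕ} (μ : Weight n) (i : ℕ) : ℂ := μ ⟨H n i, H_mem n i⟩

/-- The fundamental weight `ω_i`, the sum of the first `i` diagonal entries. Thus `ω_0 = 0`, and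
`ω_{n+1}` is the trace, which vanishes on `sl(n+1)`. -/
noncomputable def ω (n i : ℕ) : Weight n where
  toFun A := ∑ a : Fin (n + 1), if (a : ℕ) < i then A.val.val a a else 0
  map_add' A B := by
    rw [← Finset.sum_add_distrib]
    refine Finset.sum_congr rfl fun a _ => ?_
    split_ifs
    · rfl
    · rw [add_zero]
  map_smul' c A := by
    rw [RingHom.id_apply, Finset.smul_sum]
    refine Finset.sum_congr rfl fun a _ => ?_
    split_ifs
    · rfl
    · rw [smul_zero]

/-- The root vector `F_{p,q} = A_{q+1,p}` for `1 ≤ p ≤ q ≤ n` (and `0` otherwise). -/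
noncomputable def F (n p q : ℕ) : Sl n :=
  if h : 1 ≤ p ∧ p ≤ q ∧ q ≤ n then
    SpecialLinear.single ⟨q, by omega⟩ ⟨p - 1, by omega⟩
      (by rw [ne_eq, Fin.mk.injEq]; omega) (1 : ℂ)
  else 0

/-- The `j`-th standard basis vector `P_j` of `ℂ^(n+1)`, `1 ≤ j ≤ n + 1`, as an element of
`sl(n+1) ⋉ ℂ^(n+1)`. -/
noncomputable def P (n j : ℕ) : G n :=
  SemiDirectSum.inl (stdAction n)
    (toStd n fun a => if (a : ℕ) + 1 = j then 1 else 0)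

/-- `μ_{k,s} = -∑_{i=k}^s (μ_i + 1)`. -/
noncomputable def mu {n : ℕ} (μ : Weight n) (k s : ℕ) : ℂ :=
  -∑ i ∈ Finset.Icc k s, (coord μ i + 1)

/-- `F^{(μ(s))}_{i,j} = (∏_{k=i+1}^j μ_{k,s}) F_{i,j}`, in the enveloping algebra of `sl(n+1)`. -/
noncomputable def Fmu {n : ℕ} (μ : Weight n) (s i j : ℕ) : UniversalEnvelopingAlgebra ℂ (Sl n) :=
  (∏ k ∈ Finset.Icc (i + 1) j, mu μ k s) • UniversalEnvelopingAlgebra.ι ℂ (F n i j)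

/-- `P^{(μ(s))}_i = (∏_{k=1}^{i-1} μ_{k,s-1}) P_i`. -/
noncomputable def Pmu {n : ℕ} (μ : Weight n) (s i : ℕ) : G n :=
  (∏ k ∈ Finset.Icc 1 (i - 1), mu μ k (s - 1)) • P n i

/-- The elements `Q^{(μ(s))}_k` by distance from the top: `Qtop μ s d = Q^{(μ(s))}_{s+1-d}`. They
satisfy `Q^{(μ(s))}_{s+1} = I` and
`Q^{(μ(s))}_{s-d} = ∑_{l=0}^d Q^{(μ(s))}_{s-l+1} F^{(μ(s))}_{s-d,s-l}`. -/
noncomputable def Qtop {n : ℕ} (μ : Weight n) (s : ℕ) : ℕ → UniversalEnvelopingAlgebra ℂ (Sl n)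
  | 0 => 1
  | d + 1 => ∑ l : Fin (d + 1), Qtop μ s l * Fmu μ s (s - d) (s - l)

/-- `Q^{(μ(s))}_k` for `1 ≤ k ≤ s + 1`. -/
noncomputable def Q {n : ℕ} (μ : Weight n) (s k : ℕ) : UniversalEnvelopingAlgebra ℂ (Sl n) :=
  Qtop μ s (s + 1 - k)

section Module

variable {n : ℕ} {V : Type*} [AddCommGroup V] [Module ℂ V] [LieRingModule (G n) V]
  [LieModule ℂ (G n) V]

/-- The action of the enveloping algebra of `sl(n+1)` on an `sl(n+1) ⋉ ℂ^(n+1)`-module. -/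
noncomputable def act : UniversalEnvelopingAlgebra ℂ (Sl n) →ₐ[ℂ] Module.End ℂ V :=
  UniversalEnvelopingAlgebra.lift ℂ ((LieModule.toEnd ℂ (G n) V).comp (incl n))

/-- `v` is an `sl(n+1)`-highest weight vector of weight `μ`: it is non-zero, the Cartan subalgebra
acts on it through `μ`, and strictly upper triangular matrices annihilate it. -/
def IsHighestWeightVector (μ : Weight n) (v : V) : Prop :=
  v ≠ 0 ∧
    (∀ A : cartan n, ⁅incl n A.val, v⁆ = μ A • v) ∧
    ∀ A : Sl n, (∀ a b : Fin (n + 1), b ≤ a → A.val a b = 0) → ⁅incl n A, v⁆ = 0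

/-- The vector `φ_i(v)` attached to a vector `v` of weight `μ`:
`φ_i(v) = P^{(μ(i))}_i v + ∑_{k=1}^{i-1} Q^{(μ(i-1))}_k P^{(μ(i))}_k v`. -/
noncomputable def phi (μ : Weight n) (i : ℕ) (v : V) : V :=
  ⁅Pmu μ i i, v⁆ + ∑ k ∈ Finset.Icc 1 (i - 1), act (Q μ (i - 1) k) ⁅Pmu μ i k, v⁆

end Module

end SlSemidirect

/-! The vectors φ_i(φ_j(v)) and φ_j(φ_i(v)) are both singular (killed by strictly upper triangular
matrices) and have the same weight. Let 𝔫⁻ be the strictly lower triangular matrices. A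
finite-dimensional `sl(n+1)`-module has no nonzero singular vector in 𝔫⁻V, so it suffices to compare
the two vectors modulo 𝔫⁻V. There each is a scalar multiple of P_i P_j v, and the two scalars agree.

Singularity: by `phi_eq_lowering`, φ_i(v) is the last of a family of partial vectors u_1, …, u_i.
The raising operator A_{r,r+1} sends u_{r+1} to a multiple of u_r and kills every other u_j. The
multiple at u_i is an empty sum, hence 0 (`isSingular_lowering`).

Scalars (`lowering_lowering_smodEq`): moving P_i past A_{j,i} produces a correction that lowers one
factor by 1. On the other side the weight shift from μ to μ + ε_i lowers the same factor by 1.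

Vanishing in 𝔫⁻V (`IsSingular.eq_zero_of_mem_lowerSpan`): let T be the Casimir operator minus its
value at the weight ν of the singular vector. A kernel of T on a weight space strictly above ν would
yield a dominant weight strictly above ν with the same Casimir value, which is impossible. So T is
bijective on those weight spaces, hence on their image under 𝔫⁻, yet it kills the singular vector.
-/

namespace SlSemidirect

/-! ### Matrix units and their brackets in `sl(n+1)`. -/

/-- The matrix unit `A_{a,b}`, with `1 ≤ a, b ≤ n + 1`. -/
def matUnit (n a b : ℕ) : Matrix (Fin (n + 1)) (Fin (n + 1)) ℂ :=
  Matrix.of fun x y => if (x : ℕ) + 1 = a ∧ (y : ℕ) + 1 = b then 1 else 0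

theorem matUnit_apply (n a b : ℕ) (x y : Fin (n + 1)) :
    matUnit n a b x y = if (x : ℕ) + 1 = a ∧ (y : ℕ) + 1 = b then 1 else 0 := rfl

theorem matUnit_succ (n : ℕ) (x y : Fin (n + 1)) :
    matUnit n (x + 1) (y + 1) = Matrix.single x y 1 := by
  ext s t
  rw [matUnit_apply, Matrix.single_apply]
  simp only [Nat.add_right_cancel_iff, Fin.val_inj, eq_comm]

theorem exists_fin {n a : ℕ} (ha : a ∈ Finset.Icc 1 (n + 1)) : ∃ x : Fin (n + 1), a = x + 1 := by
  rw [Finset.mem_Icc] at ha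
  exact ⟨⟨a - 1, by omega⟩, by simp; omega⟩

theorem trace_matUnit {n a b : ℕ} (ha : a ∈ Finset.Icc 1 (n + 1)) (hb : b ∈ Finset.Icc 1 (n + 1)) :
    (matUnit n a b).trace = if a = b then 1 else 0 := by
  obtain ⟨x, rfl⟩ := exists_fin ha
  obtain ⟨y, rfl⟩ := exists_fin hb
  rw [matUnit_succ]
  by_cases h : x = y
  · subst h; simp
  · rw [Matrix.trace_single_eq_of_ne x y _ h, if_neg]
    simpa [Fin.val_inj] using h

theorem matUnit_mul {n a b c d : ℕ} (ha : a ∈ Finset.Icc 1 (n + 1)) (hb : b ∈ Finset.Icc 1 (n + 1))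
    (hc : c ∈ Finset.Icc 1 (n + 1)) (hd : d ∈ Finset.Icc 1 (n + 1)) :
    matUnit n a b * matUnit n c d = if b = c then matUnit n a d else 0 := by
  obtain ⟨x, rfl⟩ := exists_fin ha
  obtain ⟨y, rfl⟩ := exists_fin hb
  obtain ⟨z, rfl⟩ := exists_fin hc
  obtain ⟨t, rfl⟩ := exists_fin hd
  simp only [matUnit_succ]
  by_cases h : y = z
  · subst h; simp
  · rw [Matrix.single_mul_single_of_ne _ _ _ _ h, if_neg]
    simpa [Fin.val_inj] using h

/-- The traceless part of the matrix unit `A_{a,b}`. -/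
noncomputable def unitSl (n a b : ℕ) : Sl n :=
  ⟨matUnit n a b - ((matUnit n a b).trace / (n + 1)) • (1 : Matrix (Fin (n + 1)) (Fin (n + 1)) ℂ), by
    have h : (n : ℂ) + 1 ≠ 0 := by exact_mod_cast n.succ_ne_zero
    change Matrix.trace (_ : Matrix (Fin (n + 1)) (Fin (n + 1)) ℂ) = 0
    rw [Matrix.trace_sub, Matrix.trace_smul, Matrix.trace_one, Fintype.card_fin]
    push_cast
    rw [smul_eq_mul, div_mul_cancel₀ _ h, sub_self]⟩

theorem unitSl_val (n a b : ℕ) : (unitSl n a b).val =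
    matUnit n a b - ((matUnit n a b).trace / (n + 1)) • (1 : Matrix (Fin (n + 1)) (Fin (n + 1)) ℂ) := rfl

theorem unitSl_val_of_ne {n a b : ℕ} (ha : a ∈ Finset.Icc 1 (n + 1)) (hb : b ∈ Finset.Icc 1 (n + 1))
    (h : a ≠ b) : (unitSl n a b).val = matUnit n a b := by
  rw [unitSl_val, trace_matUnit ha hb, if_neg h, zero_div, zero_smul, sub_zero]

/-- Scalar matrices are central, so the traceless parts bracket as matrix units do. The right-hand
side needs a trace correction only when `b = c` and `d = a`, and there the two corrections cancel.
-/
theorem unitSl_lie {n a b c d : ℕ} (ha : a ∈ Finset.Icc 1 (n + 1)) (hb : b ∈ Finset.Icc 1 (n + 1))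
    (hc : c ∈ Finset.Icc 1 (n + 1)) (hd : d ∈ Finset.Icc 1 (n + 1)) :
    ⁅unitSl n a b, unitSl n c d⁆ =
      (if b = c then unitSl n a d else 0) - (if d = a then unitSl n c b else 0) := by
  apply Subtype.ext
  have key : (unitSl n a b).val * (unitSl n c d).val - (unitSl n c d).val * (unitSl n a b).val =
      (if b = c then matUnit n a d else 0) - (if d = a then matUnit n c b else 0) := by
    rw [← matUnit_mul ha hb hc hd, ← matUnit_mul hc hd ha hb, unitSl_val, unitSl_val]
    simp only [sub_mul, mul_sub, smul_mul_assoc, mul_smul_comm, one_mul, mul_one, smul_sub,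
      smul_comm ((matUnit n a b).trace / ((n : ℂ) + 1))]
    abel
  rw [SpecialLinear.sl_bracket, key]
  change _ = (ite _ _ _ : Sl n).val - (ite _ _ _ : Sl n).val
  by_cases h1 : b = c <;> by_cases h2 : d = a
  · subst h1 h2
    simp only [if_true, unitSl_val, trace_matUnit hd hd, trace_matUnit hb hb]
    abel
  · rw [if_pos h1, if_pos h1, if_neg h2, if_neg h2, unitSl_val_of_ne ha hd (Ne.symm h2)]; rfl
  · rw [if_neg h1, if_neg h1, if_pos h2, if_pos h2, unitSl_val_of_ne hc hb (Ne.symm h1)]; rfl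
  · rw [if_neg h1, if_neg h1, if_neg h2, if_neg h2]; rfl

theorem F_eq {n p q : ℕ} (hp : 1 ≤ p) (hpq : p ≤ q) (hq : q ≤ n) : F n p q = unitSl n (q + 1) p := by
  apply Subtype.ext
  rw [unitSl_val_of_ne (by simp; omega) (by simp; omega) (by omega), F, dif_pos ⟨hp, hpq, hq⟩,
    SpecialLinear.val_single, ← matUnit_succ]
  congr 1
  simp; omega

theorem H_eq {n i : ℕ} (hi : 1 ≤ i) (hin : i ≤ n) :
    H n i = unitSl n i i - unitSl n (i + 1) (i + 1) := by
  apply Subtype.ext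
  change _ = (unitSl n i i).val - (unitSl n (i + 1) (i + 1)).val
  rw [H, dif_pos ⟨hi, hin⟩, SpecialLinear.val_singleSubSingle, ← matUnit_succ, ← matUnit_succ,
    unitSl_val, unitSl_val, trace_matUnit, trace_matUnit]
  · simp only [if_true, Nat.sub_add_cancel hi]
    abel
  all_goals simp; try omega

/-! ### Weights of matrix units and of the standard basis vectors. -/

/-- The weight `ε_a = ω_a - ω_{a-1}` of the standard basis vector `P_a`. -/
noncomputable def eps (n a : ℕ) : Weight n := ω n a - ω n (a - 1)

theorem eps_succ (n : ℕ) (x : Fin (n + 1)) (A : cartan n) : eps n (x + 1) A = A.val.val x x := by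
  change (∑ a : Fin (n + 1), if (a : ℕ) < x + 1 then A.val.val a a else 0)
    - (∑ a : Fin (n + 1), if (a : ℕ) < x + 1 - 1 then A.val.val a a else 0) = _
  rw [← Finset.sum_sub_distrib, Finset.sum_eq_single x]
  · simp
  · intro b _ hb
    have : (b : ℕ) ≠ x := by simpa [Fin.val_inj] using hb
    by_cases h : (b : ℕ) < x
    · rw [if_pos (by omega), if_pos (by omega), sub_self]
    · rw [if_neg (by omega), if_neg (by omega), sub_self]
  · simp

theorem cartan_eq_diagonal {n : ℕ} (A : cartan n) :
    A.val.val = Matrix.diagonal fun x => A.val.val x x := by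
  ext x y
  by_cases h : x = y
  · subst h; simp
  · rw [Matrix.diagonal_apply_ne _ h, A.2 x y h]

theorem cartan_lie_unitSl {n a b : ℕ} (ha : a ∈ Finset.Icc 1 (n + 1))
    (hb : b ∈ Finset.Icc 1 (n + 1)) (A : cartan n) :
    ⁅A.val, unitSl n a b⁆ = (eps n a A - eps n b A) • unitSl n a b := by
  apply Subtype.ext
  have key : ∀ B : Matrix (Fin (n + 1)) (Fin (n + 1)) ℂ, ∀ t : ℂ,
      A.val.val * (B - t • 1) - (B - t • 1) * A.val.val = A.val.val * B - B * A.val.val := by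
    intro B t
    simp only [sub_mul, mul_sub, smul_mul_assoc, mul_smul_comm, one_mul, mul_one]
    abel
  rw [SpecialLinear.sl_bracket]
  change _ = (eps n a A - eps n b A) • (unitSl n a b).val
  have main : A.val.val * matUnit n a b - matUnit n a b * A.val.val =
      (eps n a A - eps n b A) • matUnit n a b := by
    obtain ⟨x, rfl⟩ := exists_fin ha
    obtain ⟨y, rfl⟩ := exists_fin hb
    rw [eps_succ, eps_succ, matUnit_succ, cartan_eq_diagonal]
    ext s t
    rw [Matrix.sub_apply, Matrix.diagonal_mul, Matrix.mul_diagonal, Matrix.smul_apply,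
      Matrix.single_apply, smul_eq_mul]
    by_cases h : x = s ∧ y = t
    · obtain ⟨rfl, rfl⟩ := h; simp
    · simp [h]
  by_cases hab : a = b
  · subst hab
    rw [unitSl_val, key, main, sub_self, zero_smul, zero_smul]
  · rw [unitSl_val_of_ne ha hb hab, main]

theorem P_lie_P (n a b : ℕ) : ⁅P n a, P n b⁆ = 0 := by
  rw [P, P, ← LieHom.map_lie, std_lie, map_zero]

theorem incl_lie_P (n c : ℕ) (A : Sl n) : ⁅incl n A, P n c⁆ =
    SemiDirectSum.inl (stdAction n) (toStd n (Matrix.mulVec A.val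
      fun a => if (a : ℕ) + 1 = c then 1 else 0)) := by
  rw [← stdAction_toStd]
  ext1
  · change ⁅_, _⁆ + _ - _ = _
    simp
    rfl
  · simp [incl, P]

theorem unitSl_lie_P {n a b c : ℕ} (ha : a ∈ Finset.Icc 1 (n + 1)) (hb : b ∈ Finset.Icc 1 (n + 1))
    (h : a ≠ b) : ⁅incl n (unitSl n a b), P n c⁆ = if b = c then P n a else 0 := by
  rw [incl_lie_P, unitSl_val_of_ne ha hb h]
  obtain ⟨x, rfl⟩ := exists_fin ha
  obtain ⟨y, rfl⟩ := exists_fin hb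
  rw [matUnit_succ]
  by_cases hc : (y : ℕ) + 1 = c
  · rw [if_pos hc, P]
    congr 2
    ext s
    subst hc
    simp only [Matrix.mulVec, dotProduct, Matrix.single_apply, Nat.add_right_cancel_iff,
      Fin.val_inj]
    rw [Finset.sum_eq_single y]
    · simp [eq_comm]
    · intro i _ hi; simp [hi]
    · simp
  · rw [if_neg hc]
    have : (Matrix.single x y (1 : ℂ)).mulVec (fun a => if (a : ℕ) + 1 = c then 1 else 0) = 0 := by
      ext s
      simp only [Matrix.mulVec, dotProduct, Matrix.single_apply, Pi.zero_apply]
      refine Finset.sum_eq_zero fun i _ => ?_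
      by_cases hi : y = i
      · subst hi; simp [hc]
      · simp [hi]
    rw [this, map_zero, map_zero]

theorem cartan_lie_P {n c : ℕ} (hc : c ∈ Finset.Icc 1 (n + 1)) (A : cartan n) :
    ⁅incl n A.val, P n c⁆ = eps n c A • P n c := by
  rw [incl_lie_P, cartan_eq_diagonal, P, ← map_smul, ← map_smul]
  congr 2
  obtain ⟨x, rfl⟩ := exists_fin hc
  ext s
  rw [Matrix.mulVec_diagonal, eps_succ]
  by_cases h : s = x
  · subst h; simp
  · simp [Fin.val_inj, h]

/-! ### Operators on a module, weight spaces and singular vectors. -/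

section Module

variable {n : ℕ} {V : Type*} [AddCommGroup V] [Module ℂ V] [LieRingModule (G n) V]
  [LieModule ℂ (G n) V]

variable (n V) in
/-- The action of the traceless part of the matrix unit `A_{a,b}` on a module. -/
noncomputable def opE (a b : ℕ) : Module.End ℂ V :=
  LieModule.toEnd ℂ (G n) V (incl n (unitSl n a b))

variable (n V) in
/-- The action of `P_c` on a module. -/
noncomputable def opP (c : ℕ) : Module.End ℂ V := LieModule.toEnd ℂ (G n) V (P n c)

theorem opE_apply (a b : ℕ) (x : V) : opE n V a b x = ⁅incl n (unitSl n a b), x⁆ := rfl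

theorem opP_apply (c : ℕ) (x : V) : opP n V c x = ⁅P n c, x⁆ := rfl

theorem opE_opE {a b c d : ℕ} (ha : a ∈ Finset.Icc 1 (n + 1)) (hb : b ∈ Finset.Icc 1 (n + 1))
    (hc : c ∈ Finset.Icc 1 (n + 1)) (hd : d ∈ Finset.Icc 1 (n + 1)) (x : V) :
    opE n V a b (opE n V c d x) = opE n V c d (opE n V a b x) +
      ((if b = c then opE n V a d x else 0) - (if d = a then opE n V c b x else 0)) := by
  simp only [opE_apply]
  rw [leibniz_lie, ← LieHom.map_lie, unitSl_lie ha hb hc hd, map_sub, sub_lie, add_comm]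
  congr 2 <;> split_ifs <;> simp only [map_zero, zero_lie]

theorem opE_opP {a b : ℕ} (ha : a ∈ Finset.Icc 1 (n + 1)) (hb : b ∈ Finset.Icc 1 (n + 1))
    (hab : a ≠ b) (c : ℕ) (x : V) :
    opE n V a b (opP n V c x) = opP n V c (opE n V a b x) + if b = c then opP n V a x else 0 := by
  simp only [opE_apply, opP_apply]
  rw [leibniz_lie, unitSl_lie_P ha hb hab, add_comm]
  congr 1
  split_ifs <;> simp only [zero_lie]

theorem opP_comm (a b : ℕ) (x : V) : opP n V a (opP n V b x) = opP n V b (opP n V a x) := by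
  simp only [opP_apply]
  rw [leibniz_lie, P_lie_P, zero_lie, zero_add]

variable (V) in
/-- The weight space of weight `ν`. -/
def weightSpace (ν : Weight n) : Submodule ℂ V where
  carrier := {x | ∀ A : cartan n, ⁅incl n A.val, x⁆ = ν A • x}
  add_mem' {x y} hx hy A := by rw [lie_add, hx A, hy A, smul_add]
  zero_mem' A := by rw [lie_zero, smul_zero]
  smul_mem' c x hx A := by rw [lie_smul, hx A, smul_comm]

theorem opE_mem {a b : ℕ} (ha : a ∈ Finset.Icc 1 (n + 1)) (hb : b ∈ Finset.Icc 1 (n + 1))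
    {ν : Weight n} {x : V} (hx : x ∈ weightSpace V ν) :
    opE n V a b x ∈ weightSpace V (ν + (eps n a - eps n b)) := by
  intro A
  rw [opE_apply, leibniz_lie, hx A, ← LieHom.map_lie, cartan_lie_unitSl ha hb, lie_smul, map_smul,
    smul_lie, ← add_smul, add_comm]
  rfl

theorem opP_mem {c : ℕ} (hc : c ∈ Finset.Icc 1 (n + 1)) {ν : Weight n} {x : V}
    (hx : x ∈ weightSpace V ν) : opP n V c x ∈ weightSpace V (ν + eps n c) := by
  intro A
  rw [opP_apply, leibniz_lie, hx A, cartan_lie_P hc, lie_smul, smul_lie, ← add_smul, add_comm]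
  rfl

theorem unitSl_self_mem (n a : ℕ) : unitSl n a a ∈ cartan n := by
  intro x y h
  change matUnit n a a x y - ((matUnit n a a).trace / (n + 1)) •
    (1 : Matrix (Fin (n + 1)) (Fin (n + 1)) ℂ) x y = 0
  rw [Matrix.one_apply_ne h, smul_zero, sub_zero, matUnit_apply, if_neg]
  rintro ⟨h1, h2⟩
  exact h (Fin.ext (by omega))

/-- The value of a weight at the traceless part of `A_{a,a}`. -/
noncomputable def wtCoord (ν : Weight n) (a : ℕ) : ℂ :=
  ν ⟨unitSl n a a, unitSl_self_mem n a⟩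

theorem opE_self_of_mem {ν : Weight n} {x : V} (hx : x ∈ weightSpace V ν) (a : ℕ) :
    opE n V a a x = wtCoord ν a • x :=
  hx ⟨unitSl n a a, unitSl_self_mem n a⟩

theorem coord_eq (ν : Weight n) {i : ℕ} (hi : 1 ≤ i) (hin : i ≤ n) :
    coord ν i = wtCoord ν i - wtCoord ν (i + 1) := by
  rw [coord, wtCoord, wtCoord, ← map_sub]
  congr 1
  exact Subtype.ext (H_eq hi hin)

theorem coord_eps {i : ℕ} (hi : 1 ≤ i) (hin : i ≤ n) {a : ℕ} (ha : a ∈ Finset.Icc 1 (n + 1)) :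
    coord (eps n a) i = (if a = i then 1 else 0) - (if a = i + 1 then 1 else 0) := by
  obtain ⟨x, rfl⟩ := exists_fin ha
  rw [coord, eps_succ]
  change (H n i).val x x = _
  rw [H, dif_pos ⟨hi, hin⟩, SpecialLinear.val_singleSubSingle, ← matUnit_succ, ← matUnit_succ]
  simp only [Matrix.sub_apply, matUnit_apply, and_self, Nat.sub_add_cancel hi]

theorem coord_add (ν ν' : Weight n) (i : ℕ) : coord (ν + ν') i = coord ν i + coord ν' i := rfl

/-- `v` has weight `μ` and is annihilated by strictly upper triangular matrices. -/
def IsSingular (μ : Weight n) (v : V) : Prop :=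
  v ∈ weightSpace V μ ∧ ∀ a b, 1 ≤ a → a < b → b ≤ n + 1 → opE n V a b v = 0

/-- The simple root vectors generate the strictly upper triangular matrices: A_{a,b+1} = [A_{a,b},
A_{b,b+1}]. -/
theorem IsSingular.of_simple {μ : Weight n} {v : V} (hv : v ∈ weightSpace V μ)
    (h : ∀ r, 1 ≤ r → r ≤ n → opE n V r (r + 1) v = 0) : IsSingular μ v := by
  refine ⟨hv, fun a b ha hab => ?_⟩
  induction b, hab using Nat.le_induction with
  | base => exact fun hb => h a ha (by omega)
  | succ b hb ih =>
    intro hbn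
    have := opE_opE (n := n) (a := a) (b := b) (c := b) (d := b + 1) (by simp; omega)
      (by simp; omega) (by simp; omega) (by simp; omega) v
    rw [h b (by omega) (by omega), ih (by omega), map_zero, map_zero, if_pos rfl,
      if_neg (by omega), sub_zero, zero_add] at this
    exact this.symm

theorem IsHighestWeightVector.isSingular {μ : Weight n} {v : V} (hv : IsHighestWeightVector μ v) :
    IsSingular μ v := by
  refine ⟨hv.2.1, fun a b ha hab hb => hv.2.2 _ fun x y hxy => ?_⟩
  rw [unitSl_val_of_ne (by simp; omega) (by simp; omega) (by omega), matUnit_apply, if_neg]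
  have : (y : ℕ) ≤ x := hxy
  omega

theorem unitSl_expand {A : Sl n} (hA : ∀ a b : Fin (n + 1), b ≤ a → A.val a b = 0) :
    A = ∑ x : Fin (n + 1), ∑ y : Fin (n + 1),
      if x < y then A.val x y • unitSl n (x + 1) (y + 1) else 0 := by
  apply Subtype.ext
  have h : ∀ x y : Fin (n + 1), (if x < y then A.val x y • unitSl n (x + 1) (y + 1) else 0 : Sl n).val
      = Matrix.single x y (A.val x y) := by
    intro x y
    split_ifs with hxy
    · change A.val x y • (unitSl n (x + 1) (y + 1)).val = _
      rw [unitSl_val_of_ne (by simp; omega) (by simp; omega) (by simpa [Fin.val_inj] using hxy.ne),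
        matUnit_succ, Matrix.smul_single, smul_eq_mul, mul_one]
    · rw [hA x y (not_lt.mp hxy), Matrix.single_zero]; rfl
  simp only [AddSubmonoidClass.coe_finsetSum, h]
  exact Matrix.matrix_eq_sum_single A.val

theorem IsSingular.isHighestWeightVector {μ : Weight n} {v : V} (hv : IsSingular μ v)
    (h0 : v ≠ 0) : IsHighestWeightVector μ v := by
  refine ⟨h0, hv.1, fun A hA => ?_⟩
  rw [unitSl_expand hA, ← LieModule.toEnd_apply_apply ℂ (G n) V]
  simp only [map_sum, LinearMap.sum_apply]
  refine Finset.sum_eq_zero fun x _ => Finset.sum_eq_zero fun y _ => ?_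
  split_ifs with hxy
  · rw [map_smul, map_smul, LinearMap.smul_apply]
    have : (x : ℕ) < y := hxy
    exact (congrArg _ (hv.2 (x + 1) (y + 1) (by omega) (by omega) (by omega))).trans (smul_zero _)
  · rw [map_zero, map_zero, LinearMap.zero_apply]

/-! ### Lowering vectors and the action of simple raising operators on them. -/

/-- The partial lowering vectors: sums over the chains `k_0 < ⋯ < k_r = j` of
`A_{j,k_{r-1}} ⋯ A_{k_1,k_0} P_{k_0} v`, each weighted by the product of `m a` over the `a < j`
outside the chain. -/
noncomputable def lowering (m : ℕ → ℂ) (v : V) (j : ℕ) : V :=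
  (∏ a ∈ Finset.Icc 1 (j - 1), m a) • opP n V j v +
    ∑ k : Fin j, if 1 ≤ (k : ℕ) then
      (∏ a ∈ Finset.Ioo (k : ℕ) j, m a) • opE n V j k (lowering m v k) else 0
termination_by j
decreasing_by exact k.2

theorem lowering_eq (m : ℕ → ℂ) (v : V) (j : ℕ) :
    lowering (n := n) m v j = (∏ a ∈ Finset.Icc 1 (j - 1), m a) • opP n V j v +
      ∑ k ∈ Finset.Ico 1 j, (∏ a ∈ Finset.Ioo k j, m a) • opE n V j k (lowering (n := n) m v k) := by
  rw [lowering, Fin.sum_univ_eq_sum_range (fun k => if 1 ≤ k then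
      (∏ a ∈ Finset.Ioo k j, m a) • opE n V j k (lowering (n := n) m v k) else 0),
    ← Finset.sum_filter]
  congr 1
  refine Finset.sum_congr ?_ fun _ _ => rfl
  ext k
  simp
  omega

theorem lowering_mem (m : ℕ → ℂ) {μ : Weight n} {v : V} (hv : v ∈ weightSpace V μ) (j : ℕ)
    (hj : j ∈ Finset.Icc 1 (n + 1)) : lowering (n := n) m v j ∈ weightSpace V (μ + eps n j) := by
  induction j using Nat.strong_induction_on with
  | _ j ih =>
    rw [lowering_eq]
    refine add_mem (Submodule.smul_mem _ _ (opP_mem hj hv)) (sum_mem fun k hk => ?_)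
    rw [Finset.mem_Ico] at hk
    have hk' : k ∈ Finset.Icc 1 (n + 1) := by rw [Finset.mem_Icc] at hj ⊢; omega
    refine Submodule.smul_mem _ _ ?_
    have := opE_mem hj hk' (ih k hk.2 hk')
    rwa [show μ + eps n k + (eps n j - eps n k) = μ + eps n j by abel] at this

/-- Induction on `j`, moving the raising operator through the recursion for the lowering vectors.
The recurrence imposed on `m` is exactly what collects the coefficients in the case `r + 1 = j`. -/
theorem opE_lowering {m : ℕ → ℂ} {μ : Weight n} {v : V} (hv : IsSingular μ v) {i : ℕ}
    (hi : i ≤ n + 1) (hm : ∀ j, 1 ≤ j → j < i → m j + (coord μ j + 1) = m (j + 1))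
    {r : ℕ} (hr : 1 ≤ r) (hrn : r ≤ n) (j : ℕ) (hj : 1 ≤ j) (hji : j ≤ i) :
    opE n V r (r + 1) (lowering (n := n) m v j) =
      if r + 1 = j then m j • lowering (n := n) m v r else 0 := by
  have hr1 : r ∈ Finset.Icc 1 (n + 1) := by simp; omega
  have hr2 : r + 1 ∈ Finset.Icc 1 (n + 1) := by simp; omega
  induction j using Nat.strong_induction_on with
  | _ j ih =>
  have hj1 : j ∈ Finset.Icc 1 (n + 1) := by simp; omega
  have step : ∀ k ∈ Finset.Ico 1 j,
      opE n V r (r + 1) (opE n V j k (lowering (n := n) m v k)) =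
      opE n V j k (if r + 1 = k then m k • lowering (n := n) m v r else 0) +
      ((if r + 1 = j then opE n V r k (lowering (n := n) m v k) else 0)
        - (if k = r then opE n V j (r + 1) (lowering (n := n) m v k) else 0)) := by
    intro k hk
    rw [Finset.mem_Ico] at hk
    rw [opE_opE hr1 hr2 hj1 (by simp; omega), ih k hk.2 hk.1 (by omega)]
  rw [lowering_eq, map_add, map_smul, opE_opP hr1 hr2 (by omega), hv.2 r (r + 1) hr (by omega) (by omega),
    map_zero, zero_add, map_sum]
  simp only [map_smul]
  rw [Finset.sum_congr rfl fun k hk => congrArg _ (step k hk)]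
  rcases lt_trichotomy (r + 1) j with h | rfl | h
  -- Only `k = r` and `k = r + 1` contribute. Both give a multiple of A_{j,r+1} u_r, with opposite
  -- signs: the factor `m (r + 1)` missing from the second product is supplied by the induction
  -- hypothesis.
  · rw [if_neg h.ne, if_neg h.ne, smul_zero, zero_add]
    have hsum : ∀ k ∈ Finset.Ico 1 j, k ≠ r ∧ k ≠ r + 1 → (∏ a ∈ Finset.Ioo k j, m a) •
        (opE n V j k (if r + 1 = k then m k • lowering (n := n) m v r else 0) +
        ((if r + 1 = j then opE n V r k (lowering (n := n) m v k) else 0)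
        - (if k = r then opE n V j (r + 1) (lowering (n := n) m v k) else 0))) = 0 := by
      intro k _ hk
      rw [if_neg (Ne.symm hk.2), if_neg h.ne, if_neg hk.1, map_zero, sub_zero, zero_add, smul_zero]
    rw [Finset.sum_eq_add r (r + 1) (by omega) hsum (by simp; omega) (by simp; omega)]
    have hp : Finset.Ioo r j = insert (r + 1) (Finset.Ioo (r + 1) j) := by ext; simp; omega
    rw [hp, Finset.prod_insert (by simp)]
    simp only [if_true, if_neg h.ne, if_neg (show r + 1 ≠ r by omega), map_zero, zero_sub, sub_zero,
      zero_add, map_smul, smul_smul, smul_neg, add_zero]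
    rw [mul_comm, neg_add_cancel]
  -- The P-term and the terms `k < r` reassemble to `m r` times u_r. The term `k = r` adds A_{r,r} -
  -- A_{r+1,r+1} acting on u_r, whose weight is μ + ε_r.
  · have hIco : Finset.Ico 1 (r + 1) = insert r (Finset.Ico 1 r) := by ext; simp; omega
    have hIcc : Finset.Icc 1 r = insert r (Finset.Icc 1 (r - 1)) := by ext; simp; omega
    rw [hIco, Finset.sum_insert (by simp), if_pos rfl, if_pos rfl, Nat.add_sub_cancel]
    simp only [if_true, if_neg (show r + 1 ≠ r by omega), map_zero, zero_add]
    rw [hIcc, Finset.prod_insert (by simp; omega)]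
    have hsum : ∀ k ∈ Finset.Ico 1 r, (∏ a ∈ Finset.Ioo k (r + 1), m a) •
        (opE n V (r + 1) k (if r + 1 = k then m k • lowering (n := n) m v r else 0) +
        (opE n V r k (lowering (n := n) m v k)
        - (if k = r then opE n V (r + 1) (r + 1) (lowering (n := n) m v k) else 0))) =
        m r • (∏ a ∈ Finset.Ioo k r, m a) • opE n V r k (lowering (n := n) m v k) := by
      intro k hk
      rw [Finset.mem_Ico] at hk
      have hp : Finset.Ioo k (r + 1) = insert r (Finset.Ioo k r) := by ext; simp; omega
      rw [if_neg (by omega), if_neg (by omega), map_zero, sub_zero, zero_add, hp,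
        Finset.prod_insert (by simp), smul_smul]
    rw [Finset.sum_congr rfl hsum, ← Finset.smul_sum, mul_smul]
    have hp : Finset.Ioo r (r + 1) = ∅ := by ext; simp
    rw [hp, Finset.prod_empty, one_smul]
    have hw : opE n V r r (lowering (n := n) m v r) -
        opE n V (r + 1) (r + 1) (lowering (n := n) m v r) =
        (coord μ r + 1) • lowering (n := n) m v r := by
      have hmem := lowering_mem m hv.1 r hr1
      rw [opE_self_of_mem hmem, opE_self_of_mem hmem, ← sub_smul, ← coord_eq _ hr hrn, coord_add,
        coord_eps hr hrn hr1, if_pos rfl, if_neg (by omega), sub_zero]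
    rw [hw, ← hm r hr (by omega), add_smul, add_left_comm, ← smul_add, ← lowering_eq, ← add_smul,
      ← add_smul, add_comm (m r)]
  · rw [if_neg h.ne', if_neg h.ne', smul_zero, zero_add]
    refine Finset.sum_eq_zero fun k hk => ?_
    rw [Finset.mem_Ico] at hk
    rw [if_neg (by omega), if_neg (by omega), if_neg (by omega), map_zero, sub_zero, zero_add,
      smul_zero]

theorem mu_succ (μ : Weight n) {j s : ℕ} (hj : j ≤ s) :
    mu μ j s + (coord μ j + 1) = mu μ (j + 1) s := by
  have hp : Finset.Icc j s = insert j (Finset.Icc (j + 1) s) := by ext; simp; omega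
  rw [mu, mu, hp, Finset.sum_insert (by simp)]
  ring

theorem mu_self (μ : Weight n) (s : ℕ) : mu μ (s + 1) s = 0 := by
  rw [mu, Finset.Icc_eq_empty (by omega), Finset.sum_empty, neg_zero]

/-- The factors `μ_{a,i-1}` entering in `φ_i`. -/
noncomputable def fac (μ : Weight n) (i a : ℕ) : ℂ := mu μ a (i - 1)

theorem isSingular_lowering {μ : Weight n} {v : V} (hv : IsSingular μ v) {i : ℕ}
    (hi : 1 ≤ i) (hin : i ≤ n + 1) :
    IsSingular (μ + eps n i) (lowering (n := n) (fac μ i) v i) := by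
  refine IsSingular.of_simple (lowering_mem _ hv.1 i (by simp; omega)) fun r hr hrn => ?_
  rw [opE_lowering (m := fac μ i) hv hin (fun j _ hji => mu_succ μ (by omega)) hr hrn i hi le_rfl]
  split_ifs with h
  -- The sum defining μ_{i,i-1} is empty.
  · have : fac μ i i = 0 := by
      obtain ⟨s, rfl⟩ : ∃ s, i = s + 1 := ⟨i - 1, by omega⟩
      exact mu_self μ s
    rw [this, zero_smul]
  · rfl

/-! ### Identification of φ_i with a lowering vector. -/

theorem Q_top (μ : Weight n) (s : ℕ) : Q μ s (s + 1) = 1 := by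
  rw [Q, Nat.sub_self, Qtop]

theorem Q_rec (μ : Weight n) {s k : ℕ} (hk : k ≤ s) :
    Q μ s k = ∑ l ∈ Finset.Ioc k (s + 1), Q μ s l * Fmu μ s k (l - 1) := by
  obtain ⟨d, rfl⟩ : ∃ d, s = k + d := ⟨s - k, by omega⟩
  rw [Q, show k + d + 1 - k = d + 1 by omega, Qtop]
  refine Finset.sum_bij (fun l _ => k + d + 1 - l) ?_ ?_ ?_ ?_
  · intro l _
    have := l.2
    simp; omega
  · intro l _ l' _ h
    have := l.2
    have := l'.2
    apply Fin.ext
    change k + d + 1 - (l : ℕ) = k + d + 1 - (l' : ℕ) at h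
    omega
  · intro b hb
    rw [Finset.mem_Ioc] at hb
    exact ⟨⟨k + d + 1 - b, by omega⟩, Finset.mem_univ _, by simp; omega⟩
  · intro l _
    have := l.2
    rw [Q]
    congr 2 <;> omega

theorem act_Q (μ : Weight n) {i k : ℕ} (hk : 1 ≤ k) (hki : k < i) (hin : i ≤ n + 1) (x : V) :
    act (n := n) (Q μ (i - 1) k) x = ∑ l ∈ Finset.Ioc k i,
      act (n := n) (Q μ (i - 1) l) ((∏ a ∈ Finset.Ioo k l, fac μ i a) • opE n V l k x) := by
  rw [Q_rec μ (by omega), map_sum, LinearMap.sum_apply, Nat.sub_add_cancel (by omega)]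
  refine Finset.sum_congr rfl fun l hl => ?_
  rw [Finset.mem_Ioc] at hl
  rw [map_mul, Module.End.mul_apply]
  congr 1
  rw [Fmu, map_smul, LinearMap.smul_apply, act, UniversalEnvelopingAlgebra.lift_ι_apply,
    F_eq hk (by omega) (by omega), Nat.sub_add_cancel (by omega)]
  congr 1
  refine Finset.prod_congr ?_ fun _ _ => rfl
  ext; simp; omega

/-- Both sides sum over the same chains, but `Q` splits off the first step of a chain and `lowering`
the last. Expanding ∑_{k≤i} Q_k u_k by the recursion for u_k, and summing the result by the
recursion for `Q`, gives φ_i(v) + ∑_{k<i} Q_k u_k. Cancellation leaves Q_i u_i = u_i. -/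
theorem phi_eq_lowering (μ : Weight n) (v : V) {i : ℕ} (hi : 1 ≤ i) (hin : i ≤ n + 1) :
    phi μ i v = lowering (n := n) (fac μ i) v i := by
  set u := lowering (n := n) (fac μ i) v with hu
  set q : ℕ → V →ₗ[ℂ] V := fun k => act (n := n) (Q μ (i - 1) k) with hq
  set g : ℕ → V := fun k => (∏ a ∈ Finset.Icc 1 (k - 1), fac μ i a) • opP n V k v with hg
  have hqi : ∀ x, q i x = x := by
    intro x
    have := Q_top μ (i - 1)
    rw [Nat.sub_add_cancel hi] at this
    simp only [hq, this, map_one, Module.End.one_apply]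
  have hphi : phi μ i v = ∑ k ∈ Finset.Icc 1 i, q k (g k) := by
    have hIcc : Finset.Icc 1 i = insert i (Finset.Icc 1 (i - 1)) := by ext; simp; omega
    have hP : ∀ k, ⁅Pmu μ i k, v⁆ = g k := fun k => by rw [Pmu, smul_lie]; rfl
    rw [hIcc, Finset.sum_insert (by simp; omega), hqi, phi, hP]
    simp only [hP]
    rfl
  have h1 : ∑ k ∈ Finset.Icc 1 i, q k (u k) = ∑ k ∈ Finset.Icc 1 i, q k (g k) +
      ∑ k ∈ Finset.Icc 1 i, ∑ l ∈ Finset.Ico 1 k,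
        q k ((∏ a ∈ Finset.Ioo l k, fac μ i a) • opE n V k l (u l)) := by
    rw [← Finset.sum_add_distrib]
    refine Finset.sum_congr rfl fun k _ => ?_
    rw [hu, lowering_eq, map_add, map_sum]
  have h2 : ∑ k ∈ Finset.Icc 1 i, ∑ l ∈ Finset.Ico 1 k,
        q k ((∏ a ∈ Finset.Ioo l k, fac μ i a) • opE n V k l (u l)) =
      ∑ l ∈ Finset.Ico 1 i, q l (u l) := by
    rw [Finset.sum_comm' (t' := Finset.Ico 1 i) (s' := fun l => Finset.Ioc l i)
      (by intro x y; simp; omega)]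
    refine Finset.sum_congr rfl fun l hl => ?_
    rw [Finset.mem_Ico] at hl
    exact (act_Q μ hl.1 hl.2 hin (u l)).symm
  have hIcc : Finset.Icc 1 i = insert i (Finset.Ico 1 i) := by ext; simp; omega
  rw [h2, ← hphi] at h1
  rw [hIcc, Finset.sum_insert (by simp), hqi] at h1
  exact (add_right_cancel h1).symm

/-! ### Comparison of the two compositions modulo 𝔫⁻V. -/

variable (V) in
/-- The vectors of weight `ν` obtained from weight vectors by strictly lower triangular matrices. -/
def lowerSpan (ν : Weight n) : Submodule ℂ V :=
  Submodule.span ℂ {y | ∃ a b, ∃ x ∈ weightSpace V (ν + (eps n b - eps n a)),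
    1 ≤ b ∧ b < a ∧ a ≤ n + 1 ∧ opE n V a b x = y}

theorem opE_mem_lowerSpan {ν ν' : Weight n} {x : V} (hx : x ∈ weightSpace V ν) {a b : ℕ}
    (hb : 1 ≤ b) (hba : b < a) (ha : a ≤ n + 1) (h : ν + (eps n a - eps n b) = ν') :
    opE n V a b x ∈ lowerSpan V ν' := by
  refine Submodule.subset_span ⟨a, b, x, ?_, hb, hba, ha, rfl⟩
  rwa [← h, show ν + (eps n a - eps n b) + (eps n b - eps n a) = ν by abel]

theorem lowering_smodEq (m : ℕ → ℂ) {μ : Weight n} {v : V} (hv : v ∈ weightSpace V μ) {j : ℕ}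
    (hj : j ≤ n + 1) :
    lowering (n := n) m v j ≡ (∏ a ∈ Finset.Icc 1 (j - 1), m a) • opP n V j v
      [SMOD lowerSpan V (μ + eps n j)] := by
  rw [SModEq.sub_mem, lowering_eq, add_sub_cancel_left]
  refine sum_mem fun k hk => Submodule.smul_mem _ _ ?_
  rw [Finset.mem_Ico] at hk
  exact opE_mem_lowerSpan (lowering_mem m hv k (by simp; omega)) hk.1 hk.2 hj (by abel)

/-- A_{j,k} with `k < j < i` commutes with P_i, so the tail stays in the image of 𝔫⁻. -/
theorem opP_lowering_smodEq_of_lt (m : ℕ → ℂ) {μ : Weight n} {v : V} (hv : v ∈ weightSpace V μ)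
    {i j : ℕ} (hji : j < i) (hi : i ≤ n + 1) :
    opP n V i (lowering (n := n) m v j) ≡
      (∏ a ∈ Finset.Icc 1 (j - 1), m a) • opP n V i (opP n V j v)
      [SMOD lowerSpan V (μ + eps n i + eps n j)] := by
  rw [SModEq.sub_mem, lowering_eq, map_add, map_smul, add_sub_cancel_left, map_sum]
  refine sum_mem fun k hk => ?_
  rw [Finset.mem_Ico] at hk
  rw [map_smul]
  refine Submodule.smul_mem _ _ ?_
  have := opE_opP (n := n) (V := V) (a := j) (b := k) (by simp; omega) (by simp; omega) (by omega) i
    (lowering (n := n) m v k)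
  rw [if_neg (by omega), add_zero] at this
  rw [← this]
  exact opE_mem_lowerSpan (opP_mem (by simp; omega) (lowering_mem m hv k (by simp; omega)))
    hk.1 hk.2 (by omega) (by abel)

/-- Here P_i fails to commute with A_{j,i}: the term `k = i` leaves -P_j u_i. This correction turns
the factor `m i` of the leading coefficient into `m i - 1`. -/
theorem opP_lowering_smodEq_of_gt (m : ℕ → ℂ) {μ : Weight n} {v : V} (hv : v ∈ weightSpace V μ)
    {i j : ℕ} (hi : 1 ≤ i) (hij : i < j) (hj : j ≤ n + 1) :
    opP n V i (lowering (n := n) m v j) ≡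
      (((∏ a ∈ Finset.Icc 1 (i - 1), m a) * ∏ a ∈ Finset.Ioo i j, m a) * (m i - 1)) •
        opP n V i (opP n V j v) [SMOD lowerSpan V (μ + eps n i + eps n j)] := by
  have h1 : opP n V i (lowering (n := n) m v j) ≡
      (∏ a ∈ Finset.Icc 1 (j - 1), m a) • opP n V i (opP n V j v) -
        (∏ a ∈ Finset.Ioo i j, m a) • opP n V j (lowering (n := n) m v i)
        [SMOD lowerSpan V (μ + eps n i + eps n j)] := by
    have hi' : i ∈ Finset.Ico 1 j := by simp; omega
    have hcomm : ∀ k ∈ Finset.Ico 1 j, opP n V i (opE n V j k (lowering (n := n) m v k)) =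
        opE n V j k (opP n V i (lowering (n := n) m v k)) -
          if k = i then opP n V j (lowering (n := n) m v k) else 0 := by
      intro k hk
      rw [Finset.mem_Ico] at hk
      rw [opE_opP (by simp; omega) (by simp; omega) (by omega), add_sub_cancel_right]
    rw [SModEq.sub_mem, lowering_eq, map_add, map_smul, map_sum]
    simp only [map_smul]
    rw [Finset.sum_congr rfl fun k hk => congrArg _ (hcomm k hk)]
    simp only [smul_sub, Finset.sum_sub_distrib, smul_ite, smul_zero]
    rw [Finset.sum_ite_eq' (Finset.Ico 1 j) i, if_pos hi', add_sub_sub_cancel,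
      sub_add_cancel]
    refine sum_mem fun k hk => Submodule.smul_mem _ _ ?_
    rw [Finset.mem_Ico] at hk
    exact opE_mem_lowerSpan (opP_mem (by simp; omega) (lowering_mem m hv k (by simp; omega)))
      hk.1 hk.2 hj (by abel)
  have h2 := opP_lowering_smodEq_of_lt m hv hij hj
  rw [add_right_comm] at h2
  refine h1.trans ((SModEq.rfl.sub (h2.smul _)).trans (SModEq.def.2 (congrArg _ ?_)))
  have hIcc : Finset.Icc 1 (j - 1) = insert i (Finset.Icc 1 (i - 1) ∪ Finset.Ioo i j) := by
    ext; simp; omega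
  rw [hIcc, Finset.prod_insert (by simp; omega), Finset.prod_union (by
    rw [Finset.disjoint_left]; intro a; simp; omega), opP_comm j i, smul_smul, ← sub_smul]
  congr 1
  ring

/-- ε_i is 1 on H_i and -1 on H_{i-1}, so μ_{a,s} changes only when the interval from a to s
separates i - 1 from i. The bounds on `a` and `s` cover the boundary cases, where H_0 or H_{n+1} is
absent. -/
theorem mu_add_eps (μ : Weight n) {i a s : ℕ} (hi : i ∈ Finset.Icc 1 (n + 1)) (ha : 1 ≤ a)
    (hs : s ≤ n) : mu (μ + eps n i) a s = mu μ a s -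
      ((if i ∈ Finset.Icc a s then 1 else 0) - (if i - 1 ∈ Finset.Icc a s then 1 else 0)) := by
  have hi' := Finset.mem_Icc.mp hi
  rw [← Finset.sum_ite_eq (Finset.Icc a s) i (fun _ => (1 : ℂ)),
    ← Finset.sum_ite_eq (Finset.Icc a s) (i - 1) (fun _ => (1 : ℂ)), ← Finset.sum_sub_distrib,
    mu, mu, ← neg_add', ← Finset.sum_add_distrib]
  congr 1
  refine Finset.sum_congr rfl fun b hb => ?_
  rw [Finset.mem_Icc] at hb
  rw [coord_add, coord_eps (by omega) (by omega) hi]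
  simp only [show i - 1 = b ↔ i = b + 1 by omega]
  ring

theorem lowering_lowering_smodEq {μ : Weight n} {v : V} (hv : v ∈ weightSpace V μ) {i j : ℕ}
    (hi : 1 ≤ i) (hij : i < j) (hj : j ≤ n + 1) :
    lowering (n := n) (fac (μ + eps n j) i) (lowering (n := n) (fac μ j) v j) i ≡
      lowering (n := n) (fac (μ + eps n i) j) (lowering (n := n) (fac μ i) v i) j
      [SMOD lowerSpan V (μ + eps n i + eps n j)] := by
  have hi' : i ∈ Finset.Icc 1 (n + 1) := by simp; omega
  have hj' : j ∈ Finset.Icc 1 (n + 1) := by simp; omega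
  have h1 := lowering_smodEq (fac (μ + eps n j) i) (lowering_mem (fac μ j) hv j hj') (j := i)
    (by omega)
  have h2 := lowering_smodEq (fac (μ + eps n i) j) (lowering_mem (fac μ i) hv i hi') hj
  rw [add_right_comm] at h1
  have h3 := opP_lowering_smodEq_of_gt (fac μ j) hv hi hij hj
  have h4 := opP_lowering_smodEq_of_lt (fac μ i) hv hij hj
  rw [add_right_comm] at h4
  refine (h1.trans (h3.smul _)).trans (((h2.trans (h4.smul _)).trans (SModEq.def.2 (congrArg _ ?_))).symm)
  have hIcc : Finset.Icc 1 (j - 1) = insert i (Finset.Icc 1 (i - 1) ∪ Finset.Ioo i j) := by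
    ext; simp; omega
  have e1 : ∀ a ∈ Finset.Icc 1 (i - 1), fac (μ + eps n j) i a = fac μ i a := by
    intro a ha
    rw [Finset.mem_Icc] at ha
    rw [fac, fac, mu_add_eps μ hj' (by omega) (by omega), if_neg (by simp; omega),
      if_neg (by simp; omega), sub_zero, sub_zero]
  have e2 : ∀ a ∈ Finset.Icc 1 (i - 1), fac (μ + eps n i) j a = fac μ j a := by
    intro a ha
    rw [Finset.mem_Icc] at ha
    rw [fac, fac, mu_add_eps μ hi' (by omega) (by omega), if_pos (by simp; omega),
      if_pos (by simp; omega), sub_self, sub_zero]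
  have e3 : ∀ a ∈ Finset.Ioo i j, fac (μ + eps n i) j a = fac μ j a := by
    intro a ha
    rw [Finset.mem_Ioo] at ha
    rw [fac, fac, mu_add_eps μ hi' (by omega) (by omega), if_neg (by simp; omega),
      if_neg (by simp; omega), sub_zero, sub_zero]
  -- The only factor changed by the shift of weight; it matches the `m i - 1` coming from the other
  -- order.
  have e4 : fac (μ + eps n i) j i = fac μ j i - 1 := by
    rw [fac, fac, mu_add_eps μ hi' (by omega) (by omega), if_pos (by simp; omega),
      if_neg (by simp; omega), sub_zero]
  rw [hIcc, Finset.prod_insert (by simp; omega), Finset.prod_union (by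
    rw [Finset.disjoint_left]; intro a; simp; omega), Finset.prod_congr rfl e1,
    Finset.prod_congr rfl e2, Finset.prod_congr rfl e3, e4, opP_comm j i, smul_smul, smul_smul]
  congr 1
  ring

/-! ### The Casimir operator and its value on singular vectors. -/

variable (n V) in
/-- The quadratic Casimir operator of `sl(n+1)`. -/
noncomputable def casimir : Module.End ℂ V :=
  ∑ a ∈ Finset.Icc 1 (n + 1), ∑ b ∈ Finset.Icc 1 (n + 1), opE n V a b * opE n V b a

theorem casimir_apply (x : V) : casimir n V x =
    ∑ a ∈ Finset.Icc 1 (n + 1), ∑ b ∈ Finset.Icc 1 (n + 1), opE n V a b (opE n V b a x) := by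
  simp only [casimir, LinearMap.sum_apply, Module.End.mul_apply]

/-- Commuting A_{c,d} through each product gives four correction terms, which cancel in pairs after
summation over the index fixed by the Kronecker delta. -/
theorem casimir_opE {c d : ℕ} (hc : c ∈ Finset.Icc 1 (n + 1)) (hd : d ∈ Finset.Icc 1 (n + 1))
    (x : V) : casimir n V (opE n V c d x) = opE n V c d (casimir n V x) := by
  have h : ∀ a ∈ Finset.Icc 1 (n + 1), ∀ b ∈ Finset.Icc 1 (n + 1),
      opE n V c d (opE n V a b (opE n V b a x)) =
        opE n V a b (opE n V b a (opE n V c d x)) +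
        ((if d = b then opE n V a d (opE n V c a x) else 0) -
          (if a = c then opE n V c b (opE n V b d x) else 0)) +
        ((if d = a then opE n V c b (opE n V b d x) else 0) -
          (if b = c then opE n V a d (opE n V c a x) else 0)) := by
    intro a ha b hb
    rw [opE_opE hc hd ha hb, opE_opE hc hd hb ha, map_add, map_sub]
    congr 2
    · congr 1 <;> split_ifs with h
      · rw [h]
      · rw [map_zero]
      · rw [h]
      · rw [map_zero]
    · split_ifs with h
      · rw [h]
      · rfl
    · split_ifs with h
      · rw [h]
      · rfl
  have h1 : ∀ (e : ℕ) (f : ℕ → V), e ∈ Finset.Icc 1 (n + 1) →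
      ∑ a ∈ Finset.Icc 1 (n + 1), ∑ b ∈ Finset.Icc 1 (n + 1), (if e = b then f a else 0) =
        ∑ a ∈ Finset.Icc 1 (n + 1), f a := by
    intro e f he
    exact Finset.sum_congr rfl fun a _ => by rw [Finset.sum_ite_eq, if_pos he]
  have h2 : ∀ (e : ℕ) (f : ℕ → V), e ∈ Finset.Icc 1 (n + 1) →
      ∑ a ∈ Finset.Icc 1 (n + 1), ∑ b ∈ Finset.Icc 1 (n + 1), (if e = a then f b else 0) =
        ∑ b ∈ Finset.Icc 1 (n + 1), f b := by
    intro e f he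
    rw [Finset.sum_comm, h1 e f he]
  rw [casimir_apply, casimir_apply, map_sum]
  simp only [map_sum]
  rw [Finset.sum_congr rfl fun a ha => Finset.sum_congr rfl fun b hb => h a ha b hb]
  simp only [Finset.sum_add_distrib, Finset.sum_sub_distrib, eq_comm (b := c)]
  rw [h1 d _ hd, h2 c _ hc, h2 d _ hd, h1 c _ hc]
  abel

/-- The eigenvalue of the Casimir operator on singular vectors of weight `ν`. -/
noncomputable def casimirValue (ν : Weight n) : ℂ :=
  ∑ a ∈ Finset.Icc 1 (n + 1), (wtCoord ν a ^ 2 + ((n : ℂ) + 2 - 2 * a) * wtCoord ν a)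

/-- Each `f a` occurs N - a times with sign + and a - 1 times with sign -. This is the 2ρ-shift in
the Casimir value. -/
theorem sum_lt_sub (N : ℕ) (f : ℕ → ℂ) :
    ∑ a ∈ Finset.Icc 1 N, ∑ b ∈ Finset.Icc 1 N, (if a < b then f a - f b else 0) =
      ∑ a ∈ Finset.Icc 1 N, ((N : ℂ) + 1 - 2 * a) * f a := by
  induction N with
  | zero => simp
  | succ N ih =>
    have h : ∀ a ∈ Finset.Icc 1 N, ∑ b ∈ Finset.Icc 1 (N + 1), (if a < b then f a - f b else 0) =
        ∑ b ∈ Finset.Icc 1 N, (if a < b then f a - f b else 0) + (f a - f (N + 1)) := by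
      intro a ha
      rw [Finset.mem_Icc] at ha
      rw [Finset.sum_Icc_succ_top (by omega), if_pos (by omega)]
    have h0 : ∑ b ∈ Finset.Icc 1 (N + 1), (if N + 1 < b then f (N + 1) - f b else 0) = 0 := by
      refine Finset.sum_eq_zero fun b hb => ?_
      rw [Finset.mem_Icc] at hb
      rw [if_neg (by omega)]
    rw [Finset.sum_Icc_succ_top (by omega), Finset.sum_congr rfl h, h0, Finset.sum_add_distrib, ih,
      Finset.sum_Icc_succ_top (by omega), Finset.sum_sub_distrib, Finset.sum_const, Nat.card_Icc,
      add_zero, nsmul_eq_mul, add_sub_assoc', ← Finset.sum_add_distrib]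
    push_cast
    rw [sub_eq_add_neg]
    congr 1
    · exact Finset.sum_congr rfl fun a _ => by ring
    · ring

theorem IsSingular.casimir_eq {ν : Weight n} {x : V} (hx : IsSingular ν x) :
    casimir n V x = casimirValue ν • x := by
  have h : ∀ a ∈ Finset.Icc 1 (n + 1), ∀ b ∈ Finset.Icc 1 (n + 1), opE n V a b (opE n V b a x) =
      ((if a < b then wtCoord ν a - wtCoord ν b else 0) + if a = b then wtCoord ν a ^ 2 else 0) • x := by
    intro a ha b hb
    have ha' := Finset.mem_Icc.mp ha
    have hb' := Finset.mem_Icc.mp hb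
    rcases lt_trichotomy a b with h | rfl | h
    · rw [if_pos h, if_neg h.ne, add_zero, opE_opE ha hb hb ha, hx.2 a b ha'.1 h hb'.2, map_zero,
        if_pos rfl, if_pos rfl, zero_add, opE_self_of_mem hx.1, opE_self_of_mem hx.1, sub_smul]
    · rw [if_neg (lt_irrefl a), if_pos rfl, zero_add, opE_self_of_mem hx.1, map_smul,
        opE_self_of_mem hx.1, smul_smul, sq]
    · rw [if_neg (by omega), if_neg (by omega), hx.2 b a hb'.1 h ha'.2, map_zero, zero_add, zero_smul]
  rw [casimir_apply, Finset.sum_congr rfl fun a ha => Finset.sum_congr rfl fun b hb => h a ha b hb]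
  simp only [← Finset.sum_smul, Finset.sum_add_distrib, sum_lt_sub, casimirValue]
  congr 1
  rw [add_comm]
  congr 1
  · refine Finset.sum_congr rfl fun a ha => ?_
    rw [Finset.sum_ite_eq, if_pos ha]
  · refine Finset.sum_congr rfl fun a _ => ?_
    push_cast
    ring

theorem casimir_mem {ν : Weight n} {x : V} (hx : x ∈ weightSpace V ν) :
    casimir n V x ∈ weightSpace V ν := by
  rw [casimir_apply]
  refine sum_mem fun a ha => sum_mem fun b hb => ?_
  have := opE_mem ha hb (opE_mem hb ha hx)
  rwa [show ν + (eps n b - eps n a) + (eps n a - eps n b) = ν by abel] at this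

/-! ### Comparison of Casimir values along the root lattice. -/

/-- The element `∑_r m_r α_r` of the root lattice. -/
noncomputable def rootSum (n : ℕ) (m : ℕ → ℕ) : Weight n :=
  ∑ r ∈ Finset.Icc 1 n, m r • (eps n r - eps n (r + 1))

theorem rootSum_add (m m' : ℕ → ℕ) : rootSum n (m + m') = rootSum n m + rootSum n m' := by
  simp only [rootSum, Pi.add_apply, add_smul, Finset.sum_add_distrib]

theorem eps_sub_eps {a b : ℕ} (hb : 1 ≤ b) (hba : b < a) (ha : a ≤ n + 1) :
    eps n b - eps n a = rootSum n fun r => if r ∈ Finset.Ico b a then 1 else 0 := by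
  simp only [rootSum, ite_smul, one_smul, zero_smul]
  rw [Finset.sum_ite_mem, Finset.inter_eq_right.mpr]
  · rw [← neg_inj, ← Finset.sum_neg_distrib]
    simp only [neg_sub]
    exact (Finset.sum_Ico_sub (eps n) hba.le).symm
  · intro r
    simp
    omega

theorem wtCoord_add (ν ν' : Weight n) (a : ℕ) : wtCoord (ν + ν') a = wtCoord ν a + wtCoord ν' a :=
  rfl

theorem wtCoord_eps {a b : ℕ} (ha : a ∈ Finset.Icc 1 (n + 1)) (hb : b ∈ Finset.Icc 1 (n + 1)) :
    wtCoord (eps n b) a = (if a = b then 1 else 0) - 1 / (n + 1) := by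
  obtain ⟨y, rfl⟩ := exists_fin hb
  rw [wtCoord, eps_succ]
  change matUnit n a a y y - ((matUnit n a a).trace / (n + 1)) •
    (1 : Matrix (Fin (n + 1)) (Fin (n + 1)) ℂ) y y = _
  rw [trace_matUnit ha ha, if_pos rfl, Matrix.one_apply_eq, smul_eq_mul, mul_one, matUnit_apply]
  simp only [and_self, eq_comm]

/-- Summation by parts; the trace corrections 1/(n+1) cancel in each simple root. -/
theorem sum_wtCoord_rootSum (m : ℕ → ℕ) (g : ℕ → ℂ) :
    ∑ a ∈ Finset.Icc 1 (n + 1), wtCoord (rootSum n m) a * g a =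
      ∑ r ∈ Finset.Icc 1 n, m r * (g r - g (r + 1)) := by
  have h : ∀ a ∈ Finset.Icc 1 (n + 1), wtCoord (rootSum n m) a * g a =
      ∑ r ∈ Finset.Icc 1 n, m r * ((if a = r then g a else 0) - if a = r + 1 then g a else 0) := by
    intro a ha
    have : wtCoord (rootSum n m) a = ∑ r ∈ Finset.Icc 1 n,
        m r * (wtCoord (eps n r) a - wtCoord (eps n (r + 1)) a) := by
      rw [wtCoord, rootSum, LinearMap.sum_apply]
      refine Finset.sum_congr rfl fun r _ => ?_
      rw [LinearMap.smul_apply, nsmul_eq_mul]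
      rfl
    rw [this, Finset.sum_mul]
    refine Finset.sum_congr rfl fun r hr => ?_
    rw [Finset.mem_Icc] at hr
    rw [wtCoord_eps ha (by simp; omega), wtCoord_eps ha (by simp; omega)]
    split_ifs <;> ring
  rw [Finset.sum_congr rfl h, Finset.sum_comm]
  refine Finset.sum_congr rfl fun r hr => ?_
  rw [Finset.mem_Icc] at hr
  rw [← Finset.mul_sum, Finset.sum_sub_distrib, Finset.sum_ite_eq', Finset.sum_ite_eq',
    if_pos (by simp; omega), if_pos (by simp; omega)]

/-- Factor the difference of squares as (x - y)(x + y + 2ρ) and pair the root-lattice element x - y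
with the other factor. The constant 2 is the step of 2ρ between consecutive indices. -/
theorem casimirValue_sub (ν : Weight n) (m : ℕ → ℕ) :
    casimirValue (ν + rootSum n m) - casimirValue ν =
      ∑ r ∈ Finset.Icc 1 n, m r * (coord (ν + rootSum n m) r + coord ν r + 2) := by
  have h := sum_wtCoord_rootSum (n := n) m
    fun a => wtCoord (ν + rootSum n m) a + wtCoord ν a + ((n : ℂ) + 2 - 2 * a)
  rw [casimirValue, casimirValue, ← Finset.sum_sub_distrib]
  refine Eq.trans (Finset.sum_congr rfl fun a _ => ?_) (h.trans (Finset.sum_congr rfl fun r hr => ?_))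
  · rw [wtCoord_add]
    ring
  · rw [Finset.mem_Icc] at hr
    rw [coord_eq _ hr.1 hr.2, coord_eq _ hr.1 hr.2]
    push_cast
    ring

/-! ### Dominance, and singular vectors inside 𝔫⁻V. -/

theorem isSl2Triple_incl {r : ℕ} (hr : 1 ≤ r) (hrn : r ≤ n) :
    IsSl2Triple (incl n (H n r)) (incl n (unitSl n r (r + 1))) (incl n (unitSl n (r + 1) r)) := by
  have hr1 : r ∈ Finset.Icc 1 (n + 1) := by simp; omega
  have hr2 : r + 1 ∈ Finset.Icc 1 (n + 1) := by simp; omega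
  have hne : r ≠ r + 1 := by omega
  refine ⟨fun h => ?_, ?_, ?_, ?_⟩
  -- The coroot is nonzero because ε_r takes the value 1 on it.
  · have h0 : H n r = 0 := congrArg SemiDirectSum.right h
    have := coord_eps (n := n) hr hrn hr1
    rw [if_pos rfl, if_neg (by omega), sub_zero, coord] at this
    have h1 : (⟨H n r, H_mem n r⟩ : cartan n) = 0 := Subtype.ext h0
    rw [h1, map_zero] at this
    exact zero_ne_one this
  · rw [← LieHom.map_lie, unitSl_lie hr1 hr2 hr2 hr1, if_pos rfl, if_pos rfl, ← H_eq hr hrn]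
  · rw [← LieHom.map_lie, H_eq hr hrn, sub_lie, unitSl_lie hr1 hr1 hr1 hr2,
      unitSl_lie hr2 hr2 hr1 hr2, if_pos rfl, if_neg hne.symm, if_neg hne.symm, if_pos rfl,
      sub_zero, zero_sub, sub_neg_eq_add, ← two_smul ℕ, map_nsmul]
  · rw [← LieHom.map_lie, H_eq hr hrn, sub_lie, unitSl_lie hr1 hr1 hr2 hr1,
      unitSl_lie hr2 hr2 hr2 hr1, if_neg hne, if_pos rfl, if_pos rfl, if_neg hne,
      sub_zero, zero_sub, ← neg_add', ← two_smul ℕ, map_neg, map_nsmul]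

theorem IsSingular.exists_nat_coord [FiniteDimensional ℂ V] {ν : Weight n} {x : V}
    (hx : IsSingular ν x) (h0 : x ≠ 0) {r : ℕ} (hr : 1 ≤ r) (hrn : r ≤ n) :
    ∃ k : ℕ, coord ν r = k := by
  have : (isSl2Triple_incl hr hrn).HasPrimitiveVectorWith x (coord ν r) :=
    ⟨h0, hx.1 ⟨H n r, H_mem n r⟩, hx.2 r (r + 1) hr (by omega) (by omega)⟩
  exact this.exists_nat

/-- Both weights are dominant integral, so the difference of Casimir values is a sum of natural
numbers m_r(p_r + q_r + 2). It vanishes only if every m_r does. -/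
theorem IsSingular.eq_zero_of_casimirValue_eq [FiniteDimensional ℂ V] {ν : Weight n} {m : ℕ → ℕ}
    {x y : V} (hx : IsSingular ν x) (hx0 : x ≠ 0) (hy : IsSingular (ν + rootSum n m) y)
    (hy0 : y ≠ 0) (h : casimirValue (ν + rootSum n m) = casimirValue ν) {r : ℕ} (hr : 1 ≤ r)
    (hrn : r ≤ n) : m r = 0 := by
  choose! p hp using fun (r : ℕ) (hr : r ∈ Finset.Icc 1 n) =>
    hx.exists_nat_coord hx0 (Finset.mem_Icc.mp hr).1 (Finset.mem_Icc.mp hr).2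
  choose! q hq using fun (r : ℕ) (hr : r ∈ Finset.Icc 1 n) =>
    hy.exists_nat_coord hy0 (Finset.mem_Icc.mp hr).1 (Finset.mem_Icc.mp hr).2
  have h1 := casimirValue_sub ν m
  rw [h, sub_self, Finset.sum_congr rfl fun r hr => by rw [hp r hr, hq r hr]] at h1
  have h2 : ∑ r ∈ Finset.Icc 1 n, m r * (q r + p r + 2) = 0 := by exact_mod_cast h1.symm
  rw [Finset.sum_eq_zero_iff] at h2
  have := h2 r (Finset.mem_Icc.mpr ⟨hr, hrn⟩)
  simpa using this

/-- Among the nonzero weight vectors with this Casimir eigenvalue and weight in ν + ∑ ℕα_r, one of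
maximal height is singular, since a simple raising operator preserves the eigenvalue and adds 1 to
the height. -/
theorem exists_isSingular [FiniteDimensional ℂ V] {ν : Weight n} {x : V}
    (hx : x ∈ weightSpace V ν) (h0 : x ≠ 0) {c : ℂ} (hc : casimir n V x = c • x) :
    ∃ (m : ℕ → ℕ) (y : V), y ≠ 0 ∧ IsSingular (ν + rootSum n m) y ∧ casimir n V y = c • y := by
  set S : Set ℕ := {t | ∃ (m : ℕ → ℕ) (y : V), y ≠ 0 ∧ y ∈ weightSpace V (ν + rootSum n m) ∧
    casimir n V y = c • y ∧ ∑ r ∈ Finset.Icc 1 n, m r = t} with hS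
  -- A grading operator: with coefficients -a every simple root has degree 1, so heights are read
  -- off from eigenvalues of `D`, of which there are finitely many.
  set D : Module.End ℂ V := ∑ a ∈ Finset.Icc 1 (n + 1), (-a : ℂ) • opE n V a a with hD
  set s : ℂ := ∑ a ∈ Finset.Icc 1 (n + 1), wtCoord ν a * (-a) with hs
  have hSfin : S.Finite := by
    refine Set.Finite.of_finite_image (f := fun t : ℕ => s + t)
      ((Module.End.finite_hasEigenvalue D).subset ?_) fun a _ b _ hab => by simpa using hab
    rintro _ ⟨t, ⟨m, y, hy0, hy, -, rfl⟩, rfl⟩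
    refine Module.End.hasEigenvalue_of_hasEigenvector (x := y)
      ⟨Module.End.mem_eigenspace_iff.mpr ?_, hy0⟩
    have hm := sum_wtCoord_rootSum (n := n) m fun a => -(a : ℂ)
    have hm' : ∑ r ∈ Finset.Icc 1 n, (m r : ℂ) * (-(r : ℂ) - -((r + 1 : ℕ) : ℂ)) =
        (∑ r ∈ Finset.Icc 1 n, m r : ℕ) := by
      push_cast
      exact Finset.sum_congr rfl fun r _ => by ring
    change D y = (s + ((∑ r ∈ Finset.Icc 1 n, m r : ℕ) : ℂ)) • y
    rw [hD, LinearMap.sum_apply, ← hm', ← hm, hs, ← Finset.sum_add_distrib, Finset.sum_smul]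
    refine Finset.sum_congr rfl fun a _ => ?_
    rw [LinearMap.smul_apply, opE_self_of_mem hy, smul_smul, wtCoord_add]
    congr 1
    ring
  have hS0 : S.Nonempty := ⟨0, 0, x, h0, by simpa [rootSum] using hx, hc, by simp⟩
  obtain ⟨t, ⟨m, y, hy0, hy, hyc, hmt⟩, hmax⟩ := Set.exists_max_image S id hSfin hS0
  refine ⟨m, y, hy0, IsSingular.of_simple hy fun r hr hrn => ?_, hyc⟩
  by_contra hne
  have hr1 : r ∈ Finset.Icc 1 (n + 1) := by simp; omega
  have hr2 : r + 1 ∈ Finset.Icc 1 (n + 1) := by simp; omega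
  have hmem : t + 1 ∈ S := by
    refine ⟨m + fun k => if k ∈ Finset.Ico r (r + 1) then 1 else 0, _, hne, ?_, ?_, ?_⟩
    · rw [rootSum_add, ← eps_sub_eps hr (by omega) (by omega), ← add_assoc]
      exact opE_mem hr1 hr2 hy
    · rw [casimir_opE hr1 hr2, hyc, map_smul]
    · simp only [Pi.add_apply, Finset.sum_add_distrib, hmt, Nat.Ico_succ_singleton,
        Finset.mem_singleton]
      rw [Finset.sum_ite_eq', if_pos (by simp; omega)]
  have := hmax _ hmem
  simp only [id] at this
  omega

/-- A singular vector in the image of the strictly lower triangular matrices vanishes. -/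
theorem IsSingular.eq_zero_of_mem_lowerSpan [FiniteDimensional ℂ V] {ν : Weight n} {w : V}
    (hw : IsSingular ν w) (hmem : w ∈ lowerSpan V ν) : w = 0 := by
  by_contra hw0
  set T : Module.End ℂ V := casimir n V - casimirValue ν • 1 with hT
  have hTx : ∀ x, T x = casimir n V x - casimirValue ν • x := fun x => rfl
  have hTE : ∀ a ∈ Finset.Icc 1 (n + 1), ∀ b ∈ Finset.Icc 1 (n + 1), ∀ x,
      T (opE n V a b x) = opE n V a b (T x) := by
    intro a ha b hb x
    rw [hTx, hTx, casimir_opE ha hb, map_sub, map_smul]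
  have hmaps : ∀ ν' : Weight n, ∀ x ∈ weightSpace V ν', T x ∈ weightSpace V ν' := fun ν' x hx =>
    sub_mem (casimir_mem hx) (Submodule.smul_mem _ _ hx)
  have hsurj : ∀ a b, 1 ≤ b → b < a → a ≤ n + 1 → ∀ x ∈ weightSpace V (ν + (eps n b - eps n a)),
      ∃ x' ∈ weightSpace V (ν + (eps n b - eps n a)), T x' = x := by
    intro a b hb hba ha x hx
    have hinj : Function.Injective (T.restrict (hmaps (ν + (eps n b - eps n a)))) := by
      rw [injective_iff_map_eq_zero]
      rintro ⟨z, hz⟩ h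
      by_contra hz0
      have hz0' : z ≠ 0 := fun h => hz0 (Subtype.ext h)
      have hTz : casimir n V z = casimirValue ν • z := sub_eq_zero.mp (congrArg Subtype.val h)
      obtain ⟨m, y, hy0, hy, hyc⟩ := exists_isSingular hz hz0' hTz
      rw [eps_sub_eps hb hba ha, add_assoc, ← rootSum_add] at hy
      have hval := smul_left_injective ℂ hy0 (hy.casimir_eq.symm.trans hyc)
      -- The simple root α_b already occurs in ε_b - ε_a, so its total coefficient is at least 1.
      have := hw.eq_zero_of_casimirValue_eq hw0 hy hy0 hval hb (by omega)
      simp [hba] at this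
    obtain ⟨⟨x', hx'⟩, h⟩ := LinearMap.injective_iff_surjective.mp hinj ⟨x, hx⟩
    exact ⟨x', hx', congrArg Subtype.val h⟩
  have hY : ∀ y ∈ lowerSpan V ν, T y ∈ lowerSpan V ν := by
    intro y hy
    refine (Submodule.span_le (p := (lowerSpan V ν).comap T)).mpr ?_ hy
    rintro _ ⟨a, b, x, hx, hb, hba, ha, rfl⟩
    change T (opE n V a b x) ∈ lowerSpan V ν
    rw [hTE a (by simp; omega) b (by simp; omega)]
    exact Submodule.subset_span ⟨a, b, _, hmaps _ x hx, hb, hba, ha, rfl⟩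
  -- `T` commutes with the lowering operators, so preimages in the source weight spaces give
  -- preimages of the generators.
  have hYsurj : lowerSpan V ν ≤ (lowerSpan V ν).map T := by
    refine Submodule.span_le.mpr ?_
    rintro _ ⟨a, b, x, hx, hb, hba, ha, rfl⟩
    obtain ⟨x', hx', rfl⟩ := hsurj a b hb hba ha x hx
    exact ⟨opE n V a b x', Submodule.subset_span ⟨a, b, x', hx', hb, hba, ha, rfl⟩,
      hTE a (by simp; omega) b (by simp; omega) x'⟩
  have hinj : Function.Injective (T.restrict hY) := by
    rw [LinearMap.injective_iff_surjective]
    rintro ⟨y, hy⟩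
    obtain ⟨y', hy', h⟩ := hYsurj hy
    exact ⟨⟨y', hy'⟩, Subtype.ext h⟩
  have h0 : T.restrict hY ⟨w, hmem⟩ = T.restrict hY 0 := by
    rw [map_zero]
    refine Subtype.ext ?_
    change T w = 0
    rw [hTx, hw.casimir_eq, sub_self]
  exact hw0 (congrArg Subtype.val (hinj h0))

/-! ### Commutation of φ_i and φ_j. -/

theorem IsSingular.sub {μ : Weight n} {v w : V} (hv : IsSingular μ v) (hw : IsSingular μ w) :
    IsSingular μ (v - w) :=
  ⟨sub_mem hv.1 hw.1, fun a b ha hab hb => by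
    rw [map_sub, hv.2 a b ha hab hb, hw.2 a b ha hab hb, sub_zero]⟩

theorem phi_isSingular {μ : Weight n} {v : V} (hv : IsSingular μ v) {i : ℕ} (hi : 1 ≤ i)
    (hin : i ≤ n + 1) : IsSingular (μ + eps n i) (phi μ i v) := by
  rw [phi_eq_lowering μ v hi hin]
  exact isSingular_lowering hv hi hin

theorem phi_phi_comm [FiniteDimensional ℂ V] {μ : Weight n} {v : V} (hv : IsSingular μ v) {i j : ℕ}
    (hi : 1 ≤ i) (hij : i < j) (hj : j ≤ n + 1) :
    phi (μ + eps n j) i (phi μ j v) = phi (μ + eps n i) j (phi μ i v) := by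
  have h1 := phi_isSingular (phi_isSingular hv (hi.trans hij.le) hj) hi (by omega)
  have h2 := phi_isSingular (phi_isSingular hv hi (by omega)) (hi.trans hij.le) hj
  rw [add_right_comm] at h1
  refine sub_eq_zero.mp ((h1.sub h2).eq_zero_of_mem_lowerSpan (SModEq.sub_mem.mp ?_))
  rw [phi_eq_lowering _ _ hi (by omega), phi_eq_lowering _ _ (hi.trans hij.le) hj,
    phi_eq_lowering _ _ hi (by omega), phi_eq_lowering _ _ (hi.trans hij.le) hj]
  exact lowering_lowering_smodEq hv.1 hi hij hj

end Module

end SlSemidirect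

theorem theorem3 (n : ℕ) (hn : 1 ≤ n) (V : Type*) [AddCommGroup V] [Module ℂ V]
    [FiniteDimensional ℂ V] [LieRingModule (SlSemidirect.G n) V]
    [LieModule ℂ (SlSemidirect.G n) V]
    (μ : SlSemidirect.Weight n) (v : V) (hv : SlSemidirect.IsHighestWeightVector μ v) :
    (∀ i : ℕ, 1 ≤ i → i ≤ n + 1 →
      SlSemidirect.phi μ i v = 0 ∨
        SlSemidirect.IsHighestWeightVector
          (μ + SlSemidirect.ω n i - SlSemidirect.ω n (i - 1)) (SlSemidirect.phi μ i v)) ∧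
    ∀ i j : ℕ, 1 ≤ i → i ≤ n + 1 → 1 ≤ j → j ≤ n + 1 →
      SlSemidirect.phi (μ + SlSemidirect.ω n j - SlSemidirect.ω n (j - 1)) i
          (SlSemidirect.phi μ j v) =
        SlSemidirect.phi (μ + SlSemidirect.ω n i - SlSemidirect.ω n (i - 1)) j
          (SlSemidirect.phi μ i v) := by
  simp only [add_sub_assoc]
  refine ⟨fun i hi hin => or_iff_not_imp_left.mpr fun h =>
    (SlSemidirect.phi_isSingular hv.isSingular hi hin).isHighestWeightVector h,
    fun i j hi hin hj hjn => ?_⟩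
  rcases lt_trichotomy i j with h | rfl | h
  · exact SlSemidirect.phi_phi_comm hv.isSingular hi h hjn
  · rfl
  · exact (SlSemidirect.phi_phi_comm hv.isSingular hj h hin).symm
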